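/- The order dimension $\dim(P)$ of a finite poset $P$ is the smallest integer $d\ge 0$ such that $P$ is isomorphic to a subposet of $\mathbb{R}^d$ with the componentwise order. Let $L$ be a finite lattice. An element of $L$ is join-irreducible if it covers exactly one element, and meet-irreducible if it is covered by exactly one element. $L$ is extremal if the maximum length $N$ of a chain of $L$ (a chain of $k+1$ elements having length $k$) equals both the number of join-irreducible and the number of meet-irreducible elements of $L$. In that case a longest chain $\hat 0=x_0\lessdot x_1\lessdot\dots\lessdot x_N=\hat 1$ numbers the join-irreducibles $j_1,\dots,j_N$ and the meet-irreducibles $m_1,\dots,m_N$ so that $x_i=j_1\vee\dots\vee j_i=m_{i+1}\wedge\dots\wedge m_N$ for $0\le i\le N$, and the Galois graph of $L$ is the directed graph on the join-irreducibles with an edge $j_i\to j_k$ whenever $i\ne k$ and $j_i\not\le m_k$. For $n>0$ let $G_n$ be the directed graph with vertices $(i,j)$, where $i\in\{1,2\}$ and $i\le j\le n$, and an edge $(i,j)\to(i',j')$ whenever $(i,j)\neq(i',j')$ and either $i=2$, $i'=1$, $j=j'$, or $i=i'=1$ and $j>j'$. The Hochschild lattice $\mathrm{Hoch}(n)$ is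 the finite extremal lattice, unique up to isomorphism, whose Galois graph is isomorphic to $G_n$. Concretely, it is the lattice of maximal orthogonal pairs of $G_n$, that is, of the pairs $(X,Y)$ of disjoint sets of vertices with no edge from $X$ to $Y$ that are maximal for componentwise inclusion, ordered by $(X,Y)\le(X',Y')$ if $X\subseteq X'$. **Proposition.** For every $n>0$, $\dim(\mathrm{Hoch}(n))=n$. Precisely: the lattice of maximal orthogonal pairs of $G_n$ is a finite extremal lattice whose Galois graph (for some longest chain) is isomorphic to $G_n$, its order dimension is $n$, and every finite extremal lattice whose Galois graph (for some longest chain) is isomorphic to $G_n$ has order dimension $n$. -/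

import Mathlib

/-- The poset `P` has order dimension `d`: `d` is the smallest natural number such that `P` is
isomorphic to a subposet of `ℝ ^ d` with the componentwise order. -/
def HasOrderDimension (P : Type*) [Preorder P] (d : ℕ) : Prop :=
  IsLeast {k : ℕ | Nonempty (P ↪o (Fin k → ℝ))} d

/-- A join-irreducible element: it covers a unique element. -/
def IsJoinIrreducible {L : Type*} [Preorder L] (a : L) : Prop :=
  ∃! b : L, b ⋖ a

/-- A meet-irreducible element: it is covered by a unique element. -/
def IsMeetIrreducible {L : Type*} [Preorder L] (a : L) : Prop :=
  ∃! b : L, a ⋖ b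

/-- An extremal (finite) lattice: the maximum length of a chain is the number of join-irreducible
elements and also the number of meet-irreducible elements. -/
def IsExtremalLattice (L : Type*) [Lattice L] : Prop :=
  Order.krullDim L = (Nat.card {a : L // IsJoinIrreducible a} : WithBot ℕ∞) ∧
    Order.krullDim L = (Nat.card {a : L // IsMeetIrreducible a} : WithBot ℕ∞)

/-- A longest chain `x 0 ⋖ x 1 ⋖ ... ⋖ x N` of the lattice `L`, from its minimum to its maximum,
with the numberings `j` of the join-irreducible elements and `m` of the meet-irreducible elements
which it determines: with indices starting at `0`, the element `x i` is the join of the `j k` with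
`k < i`, and the meet of the `m k` with `i ≤ k`. -/
structure ExtremalNumbering (L : Type*) [Lattice L] where
  length : ℕ
  chain : Fin (length + 1) → L
  chain_covBy : ∀ i : Fin length, chain i.castSucc ⋖ chain i.succ
  chain_zero : IsBot (chain 0)
  chain_last : IsTop (chain (Fin.last length))
  chain_longest : Order.krullDim L = (length : WithBot ℕ∞)
  j : Fin length ≃ {a : L // IsJoinIrreducible a}
  m : Fin length ≃ {a : L // IsMeetIrreducible a}
  isLUB_j : ∀ i : Fin (length + 1), IsLUB {a : L | ∃ k : Fin length, k.castSucc < i ∧ a = j k}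
    (chain i)
  isGLB_m : ∀ i : Fin (length + 1), IsGLB {a : L | ∃ k : Fin length, i ≤ k.castSucc ∧ a = m k}
    (chain i)

/-- The Galois graph of an extremal lattice: its vertices are the join-irreducible elements, and
there is an edge `j i → j k` if `i ≠ k` and `j i ≰ m k`. -/
def ExtremalNumbering.galoisGraph {L : Type*} [Lattice L] (ν : ExtremalNumbering L) :
    Digraph {a : L // IsJoinIrreducible a} where
  Adj a b := ∃ i k : Fin ν.length, a = ν.j i ∧ b = ν.j k ∧ i ≠ k ∧ ¬ (ν.j i : L) ≤ ν.m k

/-- The pairs `(i, j)` with `i ∈ {1, 2}` and `i ≤ j ≤ n`. -/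
abbrev HochschildVertex (n : ℕ) : Type :=
  {v : ℕ × ℕ // (v.1 = 1 ∨ v.1 = 2) ∧ v.1 ≤ v.2 ∧ v.2 ≤ n}

/-- The directed graph that defines the Hochschild lattice: `(i, j) → (i', j')` if these vertices
are distinct and either `i = 2`, `i' = 1`, `j = j'`, or `i = i' = 1` and `j > j'`. -/
def hochschildGraph (n : ℕ) : Digraph (HochschildVertex n) where
  Adj v w := v ≠ w ∧
    ((v.1.1 = 2 ∧ w.1.1 = 1 ∧ v.1.2 = w.1.2) ∨ (v.1.1 = 1 ∧ w.1.1 = 1 ∧ w.1.2 < v.1.2))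

/-- `L` is a Hochschild lattice of index `n`: a finite extremal lattice whose Galois graph is
isomorphic to `hochschildGraph n`. -/
def IsHochschildLattice (n : ℕ) (L : Type*) [Lattice L] : Prop :=
  Finite L ∧ IsExtremalLattice L ∧
    ∃ ν : ExtremalNumbering L, Nonempty (ν.galoisGraph.Adj ≃r (hochschildGraph n).Adj)

/-- An orthogonal pair of a directed graph: disjoint sets of vertices `X` and `Y` without edges
from `X` to `Y`. -/
def IsOrthogonalPair {V : Type*} (G : Digraph V) (p : Set V × Set V) : Prop :=
  Disjoint p.1 p.2 ∧ ∀ x ∈ p.1, ∀ y ∈ p.2, ¬ G.Adj x y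

/-- The maximal orthogonal pairs of a directed graph. -/
structure MaximalOrthogonalPair {V : Type*} (G : Digraph V) where
  pair : Set V × Set V
  maximal : Maximal (IsOrthogonalPair G) pair

namespace MaximalOrthogonalPair

variable {V : Type*} {G : Digraph V}

/-- Being orthogonal, as a relation between vertices. -/
def Rel (G : Digraph V) (x y : V) : Prop := x ≠ y ∧ ¬ G.Adj x y

theorem isOrthogonalPair_iff {p : Set V × Set V} :
    IsOrthogonalPair G p ↔ ∀ x ∈ p.1, ∀ y ∈ p.2, Rel G x y := by
  unfold IsOrthogonalPair Rel
  rw [Set.disjoint_iff_forall_ne]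
  exact ⟨fun h x hx y hy => ⟨h.1 hx hy, h.2 x hx y hy⟩,
    fun h => ⟨fun x hx y hy => (h x hx y hy).1, fun x hx y hy => (h x hx y hy).2⟩⟩

/-- The maximal orthogonal pairs are the formal concepts of the relation `Rel G`. -/
theorem maximal_iff {p : Set V × Set V} :
    Maximal (IsOrthogonalPair G) p ↔
      upperPolar (Rel G) p.1 = p.2 ∧ lowerPolar (Rel G) p.2 = p.1 := by
  constructor
  · intro h
    have h0 := isOrthogonalPair_iff.1 h.prop
    refine ⟨Set.Subset.antisymm ?_ fun y hy x hx => h0 x hx y hy,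
      Set.Subset.antisymm ?_ fun x hx y hy => h0 x hx y hy⟩
    · have h1 : IsOrthogonalPair G (p.1, upperPolar (Rel G) p.1) :=
        isOrthogonalPair_iff.2 fun x hx y hy => hy hx
      exact (h.le_of_ge h1 ⟨le_rfl, fun y hy x hx => h0 x hx y hy⟩).2
    · have h1 : IsOrthogonalPair G (lowerPolar (Rel G) p.2, p.2) :=
        isOrthogonalPair_iff.2 fun x hx y hy => hx hy
      exact (h.le_of_ge h1 ⟨fun x hx y hy => h0 x hx y hy, le_rfl⟩).1
  · rintro ⟨h1, h2⟩
    refine ⟨isOrthogonalPair_iff.2 fun x hx y hy => ?_, fun q hq hpq => ⟨?_, ?_⟩⟩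
    · rw [← h1] at hy
      exact hy hx
    · intro x hx
      rw [← h2]
      exact fun y hy => isOrthogonalPair_iff.1 hq x hx y (hpq.2 hy)
    · intro y hy
      rw [← h1]
      exact fun x hx => isOrthogonalPair_iff.1 hq x (hpq.1 hx) y hy

/-- Maximal orthogonal pairs as formal concepts. -/
def equivConcept (G : Digraph V) : MaximalOrthogonalPair G ≃ Concept V V (Rel G) where
  toFun p := ⟨p.pair.1, p.pair.2, (maximal_iff.1 p.maximal).1, (maximal_iff.1 p.maximal).2⟩
  invFun c := ⟨(c.extent, c.intent), maximal_iff.2 ⟨c.upperPolar_extent, c.lowerPolar_intent⟩⟩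
  left_inv _ := rfl
  right_inv _ := rfl

/-- The order on maximal orthogonal pairs: `(X, Y) ≤ (X', Y')` if `X ⊆ X'`. -/
instance : PartialOrder (MaximalOrthogonalPair G) where
  le p q := p.pair.1 ⊆ q.pair.1
  le_refl _ := Set.Subset.rfl
  le_trans _ _ _ := Set.Subset.trans
  le_antisymm _ _ h h' :=
    (equivConcept G).injective (Concept.ext (Set.Subset.antisymm h h'))

/-- Maximal orthogonal pairs as formal concepts, with their orders. -/
def orderIsoConcept (G : Digraph V) : MaximalOrthogonalPair G ≃o Concept V V (Rel G) where
  toEquiv := equivConcept G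
  map_rel_iff' := Iff.rfl

/-- The maximal orthogonal pairs form a lattice. -/
instance : Lattice (MaximalOrthogonalPair G) where
  sup p q := (orderIsoConcept G).symm (orderIsoConcept G p ⊔ orderIsoConcept G q)
  inf p q := (orderIsoConcept G).symm (orderIsoConcept G p ⊓ orderIsoConcept G q)
  le_sup_left _ _ := ((orderIsoConcept G).le_symm_apply).2 le_sup_left
  le_sup_right _ _ := ((orderIsoConcept G).le_symm_apply).2 le_sup_right
  sup_le _ _ _ h h' := ((orderIsoConcept G).symm_apply_le).2
    (sup_le ((orderIsoConcept G).monotone h) ((orderIsoConcept G).monotone h'))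
  inf_le_left _ _ := ((orderIsoConcept G).symm_apply_le).2 inf_le_left
  inf_le_right _ _ := ((orderIsoConcept G).symm_apply_le).2 inf_le_right
  le_inf _ _ _ h h' := ((orderIsoConcept G).le_symm_apply).2
    (le_inf ((orderIsoConcept G).monotone h) ((orderIsoConcept G).monotone h'))

end MaximalOrthogonalPair

/-- The Hochschild lattice `Hoch(n)`, as the lattice of maximal orthogonal pairs of
`hochschildGraph n`. -/
abbrev Hoch (n : ℕ) : Type := MaximalOrthogonalPair (hochschildGraph n)

/-! A maximal orthogonal pair is a formal concept of the relation "distinct and no edge", so each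
vertex `v` gives a least pair `joinGen v` with `v` in its first set and a greatest pair `meetGen v`
with `v` in its second, and `joinGen v ≤ meetGen w` exactly when `v`, `w` are related.

Lower bound: no edge joins any two of (1,1), (2,2), ..., (2,n), so their generators form a standard
example, which needs `n` coordinates (`le_of_standardExample`). Upper bound: the first set of a pair
meets row 1 in an initial segment, so one coordinate records row 1 and `n - 1` indicators record row
2 (`hochCoordinate_le_iff`).

The graph is acyclic, which makes the pair lattice extremal with the expected Galois graph.
Conversely a finite extremal lattice is recovered from its Galois graph
(`ExtremalNumbering.nonempty_orderIso`), so the dimension transfers. -/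

/-! ### Irreducible elements of finite lattices -/

section FiniteLattice

variable {L : Type*} [Lattice L]

theorem isJoinIrreducible_of_forall_lt_le {a b : L} (hb : b < a) (h : ∀ y, y < a → y ≤ b) :
    IsJoinIrreducible a := by
  refine ⟨b, ⟨hb, fun c hbc hca => (h c hca).not_gt hbc⟩, fun c hc => ?_⟩
  rcases (h c hc.lt).eq_or_lt with h1 | h1
  · exact h1
  · exact (hc.2 h1 hb).elim

theorem isMeetIrreducible_of_forall_lt_le {a b : L} (hb : a < b) (h : ∀ y, a < y → b ≤ y) :
    IsMeetIrreducible a := by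
  refine ⟨b, ⟨hb, fun c hac hcb => (h c hac).not_gt hcb⟩, fun c hc => ?_⟩
  rcases (h c hc.lt).eq_or_lt with h1 | h1
  · exact h1.symm
  · exact (hc.2 hb h1).elim

variable [Finite L]

/-- Every element strictly below a join-irreducible element is below its unique lower cover. -/
theorem IsJoinIrreducible.exists_forall_lt_le {a : L} (ha : IsJoinIrreducible a) :
    ∃ b, b < a ∧ ∀ y, y < a → y ≤ b := by
  obtain ⟨b, hb, hu⟩ := ha
  refine ⟨b, hb.lt, fun y hy => ?_⟩
  obtain ⟨c, hyc, hc⟩ := exists_le_covBy_of_lt hy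
  exact hu c hc ▸ hyc

theorem IsMeetIrreducible.exists_forall_lt_le {a : L} (ha : IsMeetIrreducible a) :
    ∃ b, a < b ∧ ∀ y, a < y → b ≤ y := by
  obtain ⟨b, hb, hu⟩ := ha
  refine ⟨b, hb.lt, fun y hy => ?_⟩
  obtain ⟨c, hc, hcy⟩ := exists_covBy_le_of_lt hy
  exact hu c hc ▸ hcy

/-- In a finite lattice, the order is determined by the join-irreducible elements. -/
theorem le_of_forall_isJoinIrreducible (x y : L)
    (h : ∀ a, IsJoinIrreducible a → a ≤ x → a ≤ y) : x ≤ y := by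
  induction x using WellFoundedLT.induction with
  | ind x ih =>
    by_cases hx : IsJoinIrreducible x
    · exact h x hx le_rfl
    by_cases hm : IsMin x
    · exact (hm inf_le_left).trans inf_le_right
    obtain ⟨z, hz⟩ := not_isMin_iff.1 hm
    obtain ⟨b, -, hb⟩ := exists_le_covBy_of_lt hz
    -- An element that is neither minimal nor join-irreducible is the join of two distinct lower
    -- covers, to which induction applies.
    obtain ⟨c, hc, hcb⟩ : ∃ c, c ⋖ x ∧ c ≠ b := by
      by_contra! hne
      exact hx ⟨b, hb, hne⟩
    rw [← hc.wcovBy.sup_eq hb.wcovBy hcb]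
    exact sup_le (ih c hc.lt fun a ha hac => h a ha (hac.trans hc.le))
      (ih b hb.lt fun a ha hab => h a ha (hab.trans hb.le))

/-- In a finite lattice, the order is determined by the meet-irreducible elements. -/
theorem le_of_forall_isMeetIrreducible (x y : L)
    (h : ∀ a, IsMeetIrreducible a → y ≤ a → x ≤ a) : x ≤ y := by
  induction y using WellFoundedGT.induction with
  | ind y ih =>
    by_cases hy : IsMeetIrreducible y
    · exact h y hy le_rfl
    by_cases hm : IsMax y
    · exact le_sup_left.trans (hm le_sup_right)
    obtain ⟨z, hz⟩ := not_isMax_iff.1 hm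
    obtain ⟨b, hb, -⟩ := exists_covBy_le_of_lt hz
    obtain ⟨c, hc, hcb⟩ : ∃ c, y ⋖ c ∧ c ≠ b := by
      by_contra! hne
      exact hy ⟨b, hb, hne⟩
    rw [← hc.wcovBy.inf_eq hb.wcovBy hcb]
    exact le_inf (ih c hc.lt fun a ha hac => h a ha (hc.le.trans hac))
      (ih b hb.lt fun a ha hab => h a ha (hb.le.trans hab))

end FiniteLattice

/-! ### Order dimension and standard examples -/

section OrderDimension

theorem HasOrderDimension.congr {P Q : Type*} [Preorder P] [Preorder Q] (e : P ≃o Q) {d : ℕ}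
    (h : HasOrderDimension P d) : HasOrderDimension Q d :=
  ⟨h.1.map fun f => e.symm.toOrderEmbedding.trans f,
    fun _ hk => h.2 (hk.map fun f => e.toOrderEmbedding.trans f)⟩

/-- A poset that contains the standard example with `2 * n` elements (possibly with some elements
identified) does not embed into `ℝ ^ k` for `k < n`. -/
theorem le_of_standardExample {P : Type*} [Preorder P] {n k : ℕ} (p q : Fin n → P)
    (h : ∀ c d, p c ≤ q d ↔ c ≠ d) (f : P ↪o (Fin k → ℝ)) : n ≤ k := by
  have h1 : ∀ c, ∃ i, f (q c) i < f (p c) i := by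
    intro c
    by_contra! hc
    exact (h c c).1 (f.le_iff_le.1 hc) rfl
  choose g hg using h1
  -- If `c ≠ d` shared a coordinate, then there `q c < p c ≤ q d < p d ≤ q c`.
  have hinj : Function.Injective g := by
    intro c d hcd
    by_contra hne
    have h2 := f.monotone ((h c d).2 hne) (g c)
    have h3 := f.monotone ((h d c).2 (Ne.symm hne)) (g c)
    have h4 := hg c
    have h5 := hg d
    rw [← hcd] at h5
    linarith
  simpa using Fintype.card_le_of_injective g hinj

end OrderDimension

/-! ### Generators of the lattice of maximal orthogonal pairs -/

namespace MaximalOrthogonalPair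

variable {V : Type*} {G : Digraph V}

theorem upperPolar_fst (p : MaximalOrthogonalPair G) : upperPolar (Rel G) p.pair.1 = p.pair.2 :=
  (maximal_iff.1 p.maximal).1

theorem lowerPolar_snd (p : MaximalOrthogonalPair G) : lowerPolar (Rel G) p.pair.2 = p.pair.1 :=
  (maximal_iff.1 p.maximal).2

theorem mem_snd_iff {p : MaximalOrthogonalPair G} {w : V} :
    w ∈ p.pair.2 ↔ ∀ v ∈ p.pair.1, Rel G v w := by
  rw [← upperPolar_fst]
  exact ⟨fun h v hv => h hv, fun h v hv => h v hv⟩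

theorem mem_fst_iff {p : MaximalOrthogonalPair G} {v : V} :
    v ∈ p.pair.1 ↔ ∀ w ∈ p.pair.2, Rel G v w := by
  rw [← lowerPolar_snd]
  exact ⟨fun h w hw => h hw, fun h w hw => h w hw⟩

theorem le_iff_fst {p q : MaximalOrthogonalPair G} : p ≤ q ↔ p.pair.1 ⊆ q.pair.1 := Iff.rfl

theorem le_iff_snd {p q : MaximalOrthogonalPair G} : p ≤ q ↔ q.pair.2 ⊆ p.pair.2 :=
  ⟨fun h _ hw => mem_snd_iff.2 fun v hv => mem_snd_iff.1 hw v (h hv),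
    fun h _ hv => mem_fst_iff.2 fun w hw => mem_fst_iff.1 hv w (h hw)⟩

instance [Finite V] : Finite (MaximalOrthogonalPair G) :=
  Finite.of_injective (fun p => p.pair.1) fun _ _ h =>
    le_antisymm (le_iff_fst.2 h.le) (le_iff_fst.2 h.ge)

variable (G) in
/-- The least maximal orthogonal pair whose first set contains `v`. -/
def joinGen (v : V) : MaximalOrthogonalPair G :=
  (equivConcept G).symm
    ⟨lowerPolar (Rel G) (upperPolar (Rel G) {v}), upperPolar (Rel G) {v},
      upperPolar_lowerPolar_upperPolar _ _, rfl⟩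

variable (G) in
/-- The greatest maximal orthogonal pair whose second set contains `v`. -/
def meetGen (v : V) : MaximalOrthogonalPair G :=
  (equivConcept G).symm
    ⟨lowerPolar (Rel G) {v}, upperPolar (Rel G) (lowerPolar (Rel G) {v}),
      rfl, lowerPolar_upperPolar_lowerPolar _ _⟩

theorem mem_joinGen_snd {v w : V} : w ∈ (joinGen G v).pair.2 ↔ Rel G v w := by
  show w ∈ upperPolar (Rel G) {v} ↔ _
  simp [upperPolar]

theorem mem_meetGen_fst {v w : V} : v ∈ (meetGen G w).pair.1 ↔ Rel G v w := by
  show v ∈ lowerPolar (Rel G) {w} ↔ _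
  simp [lowerPolar]

theorem joinGen_le_iff {v : V} {p : MaximalOrthogonalPair G} :
    joinGen G v ≤ p ↔ v ∈ p.pair.1 := by
  rw [le_iff_snd, mem_fst_iff]
  exact ⟨fun h w hw => mem_joinGen_snd.1 (h hw), fun h w hw => mem_joinGen_snd.2 (h w hw)⟩

theorem le_meetGen_iff {w : V} {p : MaximalOrthogonalPair G} :
    p ≤ meetGen G w ↔ w ∈ p.pair.2 := by
  rw [le_iff_fst, mem_snd_iff]
  exact ⟨fun h v hv => mem_meetGen_fst.1 (h hv), fun h v hv => mem_meetGen_fst.2 (h v hv)⟩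

theorem joinGen_le_meetGen_iff {v w : V} : joinGen G v ≤ meetGen G w ↔ Rel G v w := by
  rw [joinGen_le_iff, mem_meetGen_fst]

theorem disjoint_pair (p : MaximalOrthogonalPair G) {v : V} (h1 : v ∈ p.pair.1)
    (h2 : v ∈ p.pair.2) : False :=
  (mem_fst_iff.1 h1 v h2).1 rfl

/-- Take `v` in the first set of `p` but not in that of its lower cover `b`: a generator of `v`
strictly below `p` would lie below `b`. -/
theorem exists_eq_joinGen [Finite V] {p : MaximalOrthogonalPair G} (hp : IsJoinIrreducible p) :
    ∃ v, joinGen G v = p := by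
  obtain ⟨b, hb, h⟩ := hp.exists_forall_lt_le
  obtain ⟨v, hvp, hvb⟩ := Set.not_subset.1 (le_iff_fst.not.1 hb.not_ge)
  refine ⟨v, (joinGen_le_iff.2 hvp).eq_of_not_lt fun hlt => hvb (joinGen_le_iff.1 (h _ hlt))⟩

theorem exists_eq_meetGen [Finite V] {p : MaximalOrthogonalPair G} (hp : IsMeetIrreducible p) :
    ∃ v, meetGen G v = p := by
  obtain ⟨b, hb, h⟩ := hp.exists_forall_lt_le
  obtain ⟨v, hvp, hvb⟩ := Set.not_subset.1 (le_iff_snd.not.1 hb.not_ge)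
  refine ⟨v, ((le_meetGen_iff.2 hvp).eq_of_not_lt
    fun hlt => hvb (le_meetGen_iff.1 (h _ hlt))).symm⟩

/-! ### Acyclic graphs, enumerated so that edges go from later to earlier vertices -/

section Acyclic

variable {N : ℕ} (e : Fin N ≃ V) (he : ∀ i k, i < k → Rel G (e i) (e k))

/-- The longest chain that comes from an enumeration of the vertices of an acyclic graph: the
pairs of an initial segment and its complement. -/
def segment (i : Fin (N + 1)) : MaximalOrthogonalPair G where
  pair := ({v | (e.symm v).castSucc < i}, {v | i ≤ (e.symm v).castSucc})
  maximal := by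
    refine maximal_iff.2 ⟨Set.ext fun w => ⟨fun h => ?_, fun h v hv => ?_⟩,
      Set.ext fun v => ⟨fun h => ?_, fun h w hw => ?_⟩⟩
    · exact show i ≤ (e.symm w).castSucc from not_lt.1 fun hw => (@h w hw).1 rfl
    · simpa using he _ _ (Fin.castSucc_lt_castSucc_iff.1 (lt_of_lt_of_le hv h))
    · exact show (e.symm v).castSucc < i from not_le.1 fun hv => (@h v hv).1 rfl
    · simpa using he _ _ (Fin.castSucc_lt_castSucc_iff.1 (lt_of_lt_of_le h hw))

theorem mem_segment_fst {i : Fin (N + 1)} {v : V} :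
    v ∈ (segment e he i).pair.1 ↔ (e.symm v).castSucc < i := Iff.rfl

theorem mem_segment_snd {i : Fin (N + 1)} {v : V} :
    v ∈ (segment e he i).pair.2 ↔ i ≤ (e.symm v).castSucc := Iff.rfl

theorem segment_strictMono : StrictMono (segment e he) := by
  rw [Fin.strictMono_iff_lt_succ]
  intro i
  refine lt_of_le_not_ge (fun v hv => ?_) fun h => ?_
  · exact lt_trans (mem_segment_fst e he |>.1 hv) i.castSucc_lt_succ
  · have h1 : e i ∈ (segment e he i.succ).pair.1 := by simp [mem_segment_fst]
    have h2 := h h1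
    simp [mem_segment_fst] at h2

/-- The first sets of consecutive segments differ only in `e i`, which an intermediate pair contains
or omits. -/
theorem segment_covBy (i : Fin N) : segment e he i.castSucc ⋖ segment e he i.succ := by
  refine ⟨segment_strictMono e he i.castSucc_lt_succ, fun p h1 h2 => ?_⟩
  by_cases hi : e i ∈ p.pair.1
  · refine h2.not_ge fun v hv => ?_
    have hv' : (e.symm v).castSucc < i.succ := hv
    rcases (Fin.le_castSucc_iff.2 hv').eq_or_lt with h | h
    · rw [← Fin.castSucc_injective _ h] at hi
      simpa using hi
    · exact h1.le h
  · refine h1.not_ge fun v hv => ?_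
    have hv' : (e.symm v).castSucc < i.succ := h2.le hv
    rcases (Fin.le_castSucc_iff.2 hv').eq_or_lt with h | h
    · rw [← Fin.castSucc_injective _ h] at hi
      simp [hv] at hi
    · exact h

include he in
-- The first set of `joinGen G (e i)` has no vertex after `e i`, since those lie in the second set.
-- A strictly smaller pair also omits `e i`, so it lies below the segment of the vertices before `e
-- i`.
theorem joinGen_isJoinIrreducible (i : Fin N) : IsJoinIrreducible (joinGen G (e i)) := by
  refine isJoinIrreducible_of_forall_lt_le
    (b := joinGen G (e i) ⊓ segment e he i.castSucc) ?_ fun y hy => le_inf hy.le fun v hv => ?_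
  · refine inf_le_left.lt_of_not_ge fun h => ?_
    have h1 := joinGen_le_iff.1 (h.trans inf_le_right)
    simp [mem_segment_fst] at h1
  · by_contra h2
    have h3 : i ≤ e.symm v := by
      simpa [mem_segment_fst] using h2
    rcases h3.eq_or_lt with h4 | h4
    · refine hy.not_ge (joinGen_le_iff.2 ?_)
      rw [h4]
      simpa using hv
    · have h5 : v ∈ (joinGen G (e i)).pair.2 := mem_joinGen_snd.2 (by simpa using he _ _ h4)
      exact disjoint_pair _ (hy.le hv) h5

include he in
theorem meetGen_isMeetIrreducible (i : Fin N) : IsMeetIrreducible (meetGen G (e i)) := by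
  refine isMeetIrreducible_of_forall_lt_le
    (b := meetGen G (e i) ⊔ segment e he i.succ) ?_ fun y hy => sup_le hy.le ?_
  · refine le_sup_left.lt_of_not_ge fun h => ?_
    have h1 := le_meetGen_iff.1 (le_sup_right.trans h)
    simp [mem_segment_snd] at h1
  · refine le_iff_snd.2 fun v hv => ?_
    by_contra h2
    have h3 : e.symm v ≤ i := by
      simpa [mem_segment_snd] using h2
    rcases h3.eq_or_lt with h4 | h4
    · refine hy.not_ge (le_meetGen_iff.2 ?_)
      rw [← h4]
      simpa using hv
    · have h5 : v ∈ (meetGen G (e i)).pair.1 := mem_meetGen_fst.2 (by simpa using he _ _ h4)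
      exact disjoint_pair _ (hy.le h5) hv

include he in
theorem le_of_joinGen_le {i k : Fin N} (h : joinGen G (e i) ≤ joinGen G (e k)) : i ≤ k := by
  by_contra! hlt
  exact disjoint_pair _ (joinGen_le_iff.1 h) (mem_joinGen_snd.2 (he _ _ hlt))

include he in
theorem le_of_meetGen_le {i k : Fin N} (h : meetGen G (e i) ≤ meetGen G (e k)) : i ≤ k := by
  by_contra! hlt
  exact disjoint_pair _ (mem_meetGen_fst.2 (he _ _ hlt)) (le_meetGen_iff.1 h)

/-- The numbering of the join-irreducible elements. -/
noncomputable def joinEquiv : Fin N ≃ {a : MaximalOrthogonalPair G // IsJoinIrreducible a} :=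
  Equiv.ofBijective (fun i => ⟨joinGen G (e i), joinGen_isJoinIrreducible e he i⟩) <| by
    refine ⟨fun i k h => ?_, fun ⟨p, hp⟩ => ?_⟩
    · have h' := congrArg Subtype.val h
      exact le_antisymm (le_of_joinGen_le e he h'.le) (le_of_joinGen_le e he h'.ge)
    · have : Finite V := Finite.of_equiv _ e
      obtain ⟨v, rfl⟩ := exists_eq_joinGen hp
      exact ⟨e.symm v, Subtype.ext (by simp)⟩

/-- The numbering of the meet-irreducible elements. -/
noncomputable def meetEquiv : Fin N ≃ {a : MaximalOrthogonalPair G // IsMeetIrreducible a} :=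
  Equiv.ofBijective (fun i => ⟨meetGen G (e i), meetGen_isMeetIrreducible e he i⟩) <| by
    refine ⟨fun i k h => ?_, fun ⟨p, hp⟩ => ?_⟩
    · have h' := congrArg Subtype.val h
      exact le_antisymm (le_of_meetGen_le e he h'.le) (le_of_meetGen_le e he h'.ge)
    · have : Finite V := Finite.of_equiv _ e
      obtain ⟨v, rfl⟩ := exists_eq_meetGen hp
      exact ⟨e.symm v, Subtype.ext (by simp)⟩

theorem joinEquiv_coe (i : Fin N) :
    (joinEquiv e he i : MaximalOrthogonalPair G) = joinGen G (e i) := rfl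

theorem meetEquiv_coe (i : Fin N) :
    (meetEquiv e he i : MaximalOrthogonalPair G) = meetGen G (e i) := rfl

include he in
theorem krullDim_eq : Order.krullDim (MaximalOrthogonalPair G) = (N : WithBot ℕ∞) := by
  have : Finite V := Finite.of_equiv _ e
  have hN : Nat.card V = N := by simp [← Nat.card_congr e]
  apply le_antisymm
  · have hFin : Order.krullDim (Fin (N + 1)) ≤ (N : WithBot ℕ∞) := by
      refine iSup_le fun p => ?_
      have h := p.length_lt_card
      rw [Fintype.card_fin] at h
      exact_mod_cast Nat.le_of_lt_succ h
    -- The size of the first set grows strictly along a chain and takes values in 0, ..., `N`.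
    refine le_trans (Order.krullDim_le_of_strictMono
      (fun p => ⟨p.pair.1.ncard, Nat.lt_succ_of_le (hN ▸ Set.ncard_le_card _)⟩)
      fun p q hpq => ?_) hFin
    exact Set.ncard_lt_ncard (lt_iff_le_not_ge.2 ⟨hpq.le, fun h => hpq.not_ge h⟩) (Set.toFinite _)
  · exact Order.LTSeries.length_le_krullDim (LTSeries.mk N (segment e he) (segment_strictMono e he))

/-- The lattice of maximal orthogonal pairs of an acyclic graph, with the numbering that comes
from an enumeration of the vertices. -/
noncomputable def extremalNumbering : ExtremalNumbering (MaximalOrthogonalPair G) where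
  length := N
  chain := segment e he
  chain_covBy := segment_covBy e he
  chain_zero p v hv := absurd hv (Fin.not_lt_zero _)
  chain_last p v _ := Fin.castSucc_lt_last _
  chain_longest := krullDim_eq e he
  j := joinEquiv e he
  m := meetEquiv e he
  isLUB_j i := by
    constructor
    · rintro _ ⟨k, hk, rfl⟩
      rw [joinEquiv_coe, joinGen_le_iff, mem_segment_fst]
      simpa using hk
    · intro p hp v hv
      have h := hp ⟨e.symm v, hv, rfl⟩
      rw [joinEquiv_coe, joinGen_le_iff] at h
      simpa using h
  isGLB_m i := by
    constructor
    · rintro _ ⟨k, hk, rfl⟩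
      rw [meetEquiv_coe, le_meetGen_iff, mem_segment_snd]
      simpa using hk
    · intro p hp
      refine le_iff_snd.2 fun v hv => ?_
      have h := hp ⟨e.symm v, hv, rfl⟩
      rw [meetEquiv_coe, le_meetGen_iff] at h
      simpa using h

include he in
theorem isExtremalLattice : IsExtremalLattice (MaximalOrthogonalPair G) := by
  unfold IsExtremalLattice
  rw [krullDim_eq e he, ← Nat.card_congr (joinEquiv e he), ← Nat.card_congr (meetEquiv e he)]
  simp

/-- Loops must be excluded: the pair lattice does not see them, and a Galois graph has none. -/
theorem galoisGraph_iso (hG : ∀ v, ¬ G.Adj v v) :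
    Nonempty ((extremalNumbering e he).galoisGraph.Adj ≃r G.Adj) := by
  refine ⟨⟨(joinEquiv e he).symm.trans e, fun {a b} => ?_⟩⟩
  obtain ⟨i, rfl⟩ := (joinEquiv e he).surjective a
  obtain ⟨k, rfl⟩ := (joinEquiv e he).surjective b
  have key : ∀ i k : Fin N,
      (joinEquiv e he i : MaximalOrthogonalPair G) ≤ meetEquiv e he k ↔ Rel G (e i) (e k) :=
    fun i k => joinGen_le_meetGen_iff
  simp only [Equiv.trans_apply, Equiv.symm_apply_apply]
  constructor
  · intro h
    have hne : i ≠ k := by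
      rintro rfl
      exact hG _ h
    exact ⟨i, k, rfl, rfl, hne, fun hle => ((key i k).1 hle).2 h⟩
  · rintro ⟨i', k', hi, hk, hne, hle⟩
    obtain rfl := (joinEquiv e he).injective hi
    obtain rfl := (joinEquiv e he).injective hk
    by_contra hadj
    exact hle ((key i k).2 ⟨fun h => hne (e.injective h), hadj⟩)

end Acyclic

end MaximalOrthogonalPair

open MaximalOrthogonalPair

/-! ### Recovering an extremal lattice from its Galois graph -/

namespace ExtremalNumbering

variable {L : Type*} [Lattice L] (ν : ExtremalNumbering L)

/-- Otherwise `chain i.succ`, the join of `chain i.castSucc` and `j i`, would lie below every `m k`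
with `k ≥ i`, hence below their meet `chain i.castSucc`. -/
theorem j_not_le_m (i : Fin ν.length) : ¬ (ν.j i : L) ≤ ν.m i := by
  intro h
  refine (ν.chain_covBy i).lt.not_ge ((ν.isGLB_m i.castSucc).2 ?_)
  rintro _ ⟨k, hk, rfl⟩
  rcases hk.eq_or_lt with hk | hk
  · obtain rfl := Fin.castSucc_injective _ hk
    refine (ν.isLUB_j i.succ).2 ?_
    rintro _ ⟨l, hl, rfl⟩
    rcases (Fin.le_castSucc_iff.2 hl).eq_or_lt with hl | hl
    · obtain rfl := Fin.castSucc_injective _ hl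
      exact h
    · exact ((ν.isLUB_j i.castSucc).1 ⟨l, hl, rfl⟩).trans
        ((ν.isGLB_m i.castSucc).1 ⟨i, le_rfl, rfl⟩)
  · exact (ν.isGLB_m i.succ).1 ⟨k, Fin.castSucc_lt_iff_succ_le.1 hk, rfl⟩

theorem j_le_m_iff (i k : Fin ν.length) :
    (ν.j i : L) ≤ ν.m k ↔ Rel ν.galoisGraph (ν.j i) (ν.j k) := by
  constructor
  · intro h
    refine ⟨fun hik => ?_, ?_⟩
    · obtain rfl := ν.j.injective hik
      exact ν.j_not_le_m _ h
    · rintro ⟨i', k', hi, hk, -, hle⟩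
      obtain rfl := ν.j.injective hi
      obtain rfl := ν.j.injective hk
      exact hle h
  · rintro ⟨h1, h2⟩
    by_contra hle
    exact h2 ⟨i, k, rfl, rfl, fun h => h1 (congrArg _ h), hle⟩

/-- A finite extremal lattice is the lattice of maximal orthogonal pairs of its Galois graph. -/
theorem nonempty_orderIso [Finite L] {V : Type*} {G : Digraph V} (f : ν.galoisGraph.Adj ≃r G.Adj) :
    Nonempty (L ≃o MaximalOrthogonalPair G) := by
  let a : V → Fin ν.length := fun v => ν.j.symm (f.symm v)
  have ha : ∀ i, ∃ v, a v = i := fun i => ⟨f (ν.j i), by simp [a]⟩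
  have hrel : ∀ v w, (ν.j (a v) : L) ≤ ν.m (a w) ↔ Rel G v w := by
    intro v w
    rw [j_le_m_iff]
    have h : ν.galoisGraph.Adj (f.symm v) (f.symm w) ↔ G.Adj v w := f.symm.map_rel_iff
    simp [a, MaximalOrthogonalPair.Rel, h]
  have hj : ∀ x y : L, (∀ v, (ν.j (a v) : L) ≤ x → (ν.j (a v) : L) ≤ y) → x ≤ y := by
    intro x y h
    refine le_of_forall_isJoinIrreducible x y fun b hb => ?_
    obtain ⟨v, hv⟩ := ha (ν.j.symm ⟨b, hb⟩)
    simpa [hv] using h v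
  have hm : ∀ x y : L, (∀ v, y ≤ (ν.m (a v) : L) → x ≤ (ν.m (a v) : L)) → x ≤ y := by
    intro x y h
    refine le_of_forall_isMeetIrreducible x y fun b hb => ?_
    obtain ⟨v, hv⟩ := ha (ν.m.symm ⟨b, hb⟩)
    simpa [hv] using h v
  -- Maximality of this pair says that irreducibles determine the order, which is `hj` and `hm`.
  let F : L → MaximalOrthogonalPair G := fun x =>
    { pair := ({v | (ν.j (a v) : L) ≤ x}, {w | x ≤ (ν.m (a w) : L)})
      maximal := by
        refine maximal_iff.2 ⟨Set.ext fun w => ⟨fun h => ?_, fun h v hv => ?_⟩,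
          Set.ext fun v => ⟨fun h => ?_, fun h w hw => ?_⟩⟩
        · exact hj _ _ fun v hv => (hrel v w).2 (h hv)
        · exact (hrel v w).1 (le_trans hv h)
        · exact hm _ _ fun w hw => (hrel v w).2 (h hw)
        · exact (hrel v w).1 (le_trans h hw) }
  have hF : ∀ x y, F x ≤ F y ↔ x ≤ y :=
    fun x y => ⟨fun h => hj x y fun v hv => h hv, fun h v hv => le_trans hv h⟩
  refine ⟨RelIso.ofSurjective (OrderEmbedding.ofMapLEIff F hF) fun p => ?_⟩
  -- The preimage of `p` is the join of the join-irreducibles indexed by its first set.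
  obtain ⟨x, hx⟩ : ∃ x, IsLUB {y : L | ∃ v ∈ p.pair.1, y = ν.j (a v)} x := by
    let : OrderBot L := { bot := ν.chain 0, bot_le := ν.chain_zero }
    have h := Finset.isLUB_sup_id
      (s := (Set.toFinite {y : L | ∃ v ∈ p.pair.1, y = ν.j (a v)}).toFinset)
    rw [Set.Finite.coe_toFinset] at h
    exact ⟨_, h⟩
  refine ⟨x, le_antisymm (fun v hv => mem_fst_iff.2 fun w hw => ?_) fun v hv => hx.1 ⟨v, hv, rfl⟩⟩
  refine (hrel v w).1 (le_trans hv (hx.2 ?_))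
  rintro _ ⟨u, hu, rfl⟩
  exact (hrel u w).2 (mem_fst_iff.1 hu w hw)

end ExtremalNumbering

/-! ### The Hochschild graph and its coordinates -/

section Hochschild

theorem hochschildVertex_finite (n : ℕ) : Finite (HochschildVertex n) := by
  refine Set.Finite.to_subtype (s := {v : ℕ × ℕ | (v.1 = 1 ∨ v.1 = 2) ∧ v.1 ≤ v.2 ∧ v.2 ≤ n})
    (((Set.finite_Iic 2).prod (Set.finite_Iic n)).subset fun v hv => ⟨?_, hv.2.2⟩)
  rcases hv.1 with h | h <;> simp [h]

theorem exists_enumeration_strictMono {V α : Type*} [Finite V] [LinearOrder α] (f : V → α)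
    (hf : Function.Injective f) :
    ∃ e : Fin (Nat.card V) ≃ V, ∀ i k, i < k → f (e i) < f (e k) := by
  have := Fintype.ofFinite V
  let : LinearOrder V := LinearOrder.lift' f hf
  let e := Fintype.orderIsoFinOfCardEq V Nat.card_eq_fintype_card.symm
  exact ⟨e.toEquiv, fun i k hik => e.strictMono hik⟩

/-- Every edge strictly decreases the lexicographic order on (row, index). -/
theorem hochschild_exists_enumeration (n : ℕ) :
    ∃ e : Fin (Nat.card (HochschildVertex n)) ≃ HochschildVertex n,
      ∀ i k, i < k → Rel (hochschildGraph n) (e i) (e k) := by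
  have := hochschildVertex_finite n
  obtain ⟨e, he⟩ := exists_enumeration_strictMono (fun v : HochschildVertex n => toLex v.1)
    fun v w h => Subtype.ext (toLex.injective h)
  refine ⟨e, fun i k hik => ⟨fun h => hik.ne (e.injective h), ?_⟩⟩
  have h := he i k hik
  rw [Prod.Lex.toLex_lt_toLex] at h
  rintro ⟨-, h2⟩
  omega

theorem isHochschildLattice_hoch (n : ℕ) : IsHochschildLattice n (Hoch n) := by
  have := hochschildVertex_finite n
  obtain ⟨e, he⟩ := hochschild_exists_enumeration n
  exact ⟨inferInstance, isExtremalLattice e he, extremalNumbering e he,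
    galoisGraph_iso e he fun v h => h.1 rfl⟩

/-- The vertices `(1, 1), (2, 2), ..., (2, n)`. -/
def criticalVertex {n : ℕ} (c : Fin n) : HochschildVertex n :=
  ⟨(if c.1 = 0 then 1 else 2, c.1 + 1), by split_ifs <;> simp, by split_ifs <;> omega, by omega⟩

/-- An edge needs equal second coordinates or both ends in row 1; these vertices have distinct
second coordinates and only one is in row 1. -/
theorem rel_criticalVertex_iff {n : ℕ} (c d : Fin n) :
    Rel (hochschildGraph n) (criticalVertex c) (criticalVertex d) ↔ c ≠ d := by
  constructor
  · rintro h rfl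
    exact h.1 rfl
  · intro h
    have h' : c.1 ≠ d.1 := fun h1 => h (Fin.ext h1)
    refine ⟨fun h1 => ?_, ?_⟩
    · have := congrArg (fun v => v.1.2) h1
      simp only [criticalVertex] at this
      omega
    · rintro ⟨-, h1⟩
      simp only [criticalVertex] at h1
      split_ifs at h1 <;> omega

/-- The indices `j` such that `(1, j)` belongs to the first set of the pair. -/
def firstRow {n : ℕ} (p : Hoch n) : Set ℕ := {j | ∃ v ∈ p.pair.1, v.1.1 = 1 ∧ j ≤ v.1.2}

/-- If (1,u) is in the first set, row-1 vertices of the second set have index above `u`. Edges out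
of (1,j) go to smaller indices in row 1, so for `j ≤ u` they miss the second set. A nonempty
`firstRow` also contains 0, which affects no comparison. -/
theorem mem_fst_iff_mem_firstRow {n : ℕ} {p : Hoch n} {v : HochschildVertex n} (hv : v.1.1 = 1) :
    v ∈ p.pair.1 ↔ v.1.2 ∈ firstRow p := by
  refine ⟨fun h => ⟨v, h, hv, le_rfl⟩, ?_⟩
  rintro ⟨u, hu, hu1, huv⟩
  refine mem_fst_iff.2 fun w hw => ?_
  obtain ⟨h1, h2⟩ := mem_fst_iff.1 hu w hw
  have hwu : w.1.1 = 1 → u.1.2 < w.1.2 := by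
    intro hw1
    rcases lt_trichotomy u.1.2 w.1.2 with h | h | h
    · exact h
    · exact (h1 (Subtype.ext (Prod.ext (hu1.trans hw1.symm) h))).elim
    · exact (h2 ⟨h1, Or.inr ⟨hu1, hw1, h⟩⟩).elim
  refine ⟨?_, ?_⟩
  · rintro rfl
    exact (hwu hv).not_ge huv
  · rintro ⟨-, h | h⟩
    · omega
    · have := hwu h.2.1
      omega

theorem firstRow_finite {n : ℕ} (p : Hoch n) : (firstRow p).Finite := by
  refine (Set.finite_Iic n).subset ?_
  rintro j ⟨v, -, -, h⟩
  exact h.trans v.2.2.2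

theorem firstRow_isLowerSet {n : ℕ} (p : Hoch n) : IsLowerSet (firstRow p) := by
  rintro i j hij ⟨v, hv, h1, h2⟩
  exact ⟨v, hv, h1, hij.trans h2⟩

/-- Lower sets of ℕ form a chain under inclusion, so one number encodes row 1. -/
theorem firstRow_subset_iff {n : ℕ} (p q : Hoch n) :
    firstRow p ⊆ firstRow q ↔ (firstRow p).ncard ≤ (firstRow q).ncard := by
  refine ⟨fun h => Set.ncard_le_ncard h (firstRow_finite q), fun h => ?_⟩
  rcases (firstRow_isLowerSet p).total (firstRow_isLowerSet q) with h1 | h1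
  · exact h1
  · exact (Set.eq_of_subset_of_ncard_le h1 h (firstRow_finite p)).ge

open Classical in
/-- The coordinates of a maximal orthogonal pair: the number of indices in its first row, and the
indicators of the vertices `(2, 2), ..., (2, n)`. -/
noncomputable def hochCoordinate {n : ℕ} (p : Hoch n) (c : Fin n) : ℝ :=
  if c.1 = 0 then ((firstRow p).ncard : ℝ) else if criticalVertex c ∈ p.pair.1 then 1 else 0

theorem hochCoordinate_le_iff {n : ℕ} (hn : 0 < n) (p q : Hoch n) :
    hochCoordinate p ≤ hochCoordinate q ↔ p ≤ q := by
  constructor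
  · intro h v hv
    rcases v.2.1 with h1 | h1
    · have h2 := h ⟨0, hn⟩
      simp only [hochCoordinate, if_true, Nat.cast_le, ← firstRow_subset_iff] at h2
      exact (mem_fst_iff_mem_firstRow h1).2 (h2 ((mem_fst_iff_mem_firstRow h1).1 hv))
    · obtain ⟨-, h2, h3⟩ := v.2
      -- Coordinates start at 0, so (2,j) has coordinate `j - 1`, nonzero since `j ≥ 2`.
      have hc : criticalVertex ⟨v.1.2 - 1, by omega⟩ = v := by
        refine Subtype.ext (Prod.ext ?_ ?_)
        · simp only [criticalVertex]
          rw [if_neg (by omega), h1]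
        · simp only [criticalVertex]
          omega
      have h4 := h ⟨v.1.2 - 1, by omega⟩
      by_contra hq
      simp only [hochCoordinate, hc, hv, hq, if_true, if_false] at h4
      rw [if_neg (by omega), if_neg (by omega)] at h4
      linarith
  · intro h c
    unfold hochCoordinate
    split_ifs with h1 h2 h3
    · refine Nat.cast_le.2 ((firstRow_subset_iff p q).1 ?_)
      rintro j ⟨v, hv, hj⟩
      exact ⟨v, h hv, hj⟩
    · exact le_rfl
    · exact (h3 (h h2)).elim
    · exact zero_le_one
    · exact le_rfl

theorem hasOrderDimension_hoch {n : ℕ} (hn : 0 < n) : HasOrderDimension (Hoch n) n := by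
  refine ⟨⟨OrderEmbedding.ofMapLEIff hochCoordinate (hochCoordinate_le_iff hn)⟩, ?_⟩
  rintro k ⟨f⟩
  refine le_of_standardExample (fun c => joinGen _ (criticalVertex c))
    (fun c => meetGen _ (criticalVertex c)) (fun c d => ?_) f
  rw [joinGen_le_meetGen_iff, rel_criticalVertex_iff]

end Hochschild

theorem mainTheorem12 (n : ℕ) (hn : 0 < n) :
    IsHochschildLattice n (Hoch n) ∧
      HasOrderDimension (Hoch n) n ∧
      ∀ (L : Type*) [Lattice L], IsHochschildLattice n L → HasOrderDimension L n := by
  refine ⟨isHochschildLattice_hoch n, hasOrderDimension_hoch hn, ?_⟩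
  rintro L _ ⟨hfin, -, ν, ⟨f⟩⟩
  obtain ⟨g⟩ := ν.nonempty_orderIso f
  exact (hasOrderDimension_hoch hn).congr g.symm
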